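/- **Proposition 5.5.** Let $(X,\lhd)$ be a quandle: $a\lhd a=a$, every map $\bullet\lhd a$ is bijective, and $(a\lhd b)\lhd c=(a\lhd c)\lhd(b\lhd c)$. Let $\mathrm{As}(X)=\langle e_x\ (x\in X)\mid e_{x\lhd y}^{-1}e_y^{-1}e_xe_y\ (x,y\in X)\rangle$ be its adjoint group, acting on $X$ from the right by $x\cdot e_y=x\lhd y$. Assume that $X$ is connected, i.e. this action has exactly one orbit, and that $X$ is of finite type $t_X$, i.e. $t_X\ge 1$ is the least positive integer $N$ such that $(\cdots((x\lhd y)\lhd y)\cdots)\lhd y=x$ ($N$ operations by $y$) for all $x,y\in X$; $X$ may be infinite. Fix $a\in X$, let $\varepsilon:\mathrm{As}(X)\to\mathbb Z$ be the homomorphism with $\varepsilon(e_x)=1$ for all $x\in X$, and let $\widetilde X$ be the quandle with underlying set $\mathrm{Ker}(\varepsilon)$ and operation $g\lhd h=e_a^{-1}gh^{-1}e_ah$. Let $p:\widetilde X\to X$, $p(g)=a\cdot g$, be the universal covering, and let $p_*:\mathrm{As}(\widetilde X)\to\mathrm{As}(X)$, $e_g\mapsto e_{p(g)}$, be the induced homomorphism.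 Then the map $$p_*:H_3^{\mathrm{gr}}(\mathrm{As}(\widetilde X))\longrightarrow H_3^{\mathrm{gr}}(\mathrm{As}(X))$$ induced on group homology with trivial integral coefficients is a $[1/t_X]$-isomorphism; that is, for every prime $\ell$ not dividing $t_X$, its localization at $\ell$ (at the prime ideal $(\ell)$ of $\mathbb Z$) is an isomorphism. -/

import Mathlib

open Quandles

noncomputable section

universe u v

/-!
Conventions.  A quandle in the right-handed convention is a set with a binary operation
`x ⊲ y` such that `a ⊲ a = a`, every map `x ↦ x ⊲ a` is bijective, and
`(a ⊲ b) ⊲ c = (a ⊲ c) ⊲ (b ⊲ c)`.  Under the dictionary `x ⊲ y = y ◃ x` these are exactly the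
axioms of Mathlib's class `Quandle`, and right-handed quandle homomorphisms are exactly Mathlib's
`X →◃ Y`.  The dictionary is used throughout.  The adjoint group below uses the right-handed
relations `e_{x ⊲ y} = e_y⁻¹ e_x e_y` (Mathlib's `Rack.EnvelGroup` is the opposite group).
-/

namespace QuandleCovering

/-- The right-handed quandle operation `x ⊲ y`. -/
def lhd {X : Type u} [Quandle X] (x y : X) : X := y ◃ x

/-- `X` is of type `t`: `t` is the least positive `N` such that
`(⋯((x ⊲ y) ⊲ y)⋯) ⊲ y = x` (`N` times) for all `x, y`. -/
def IsOfType (X : Type u) [Quandle X] (t : ℕ) : Prop :=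
  IsLeast {N : ℕ | 0 < N ∧ ∀ x y : X, (fun z => lhd z y)^[N] x = x} t

/-- The relators `e_{x ⊲ y}⁻¹ e_y⁻¹ e_x e_y` of the adjoint group. -/
def adjointRels (X : Type u) [Quandle X] : Set (FreeGroup X) :=
  Set.range fun q : X × X =>
    (FreeGroup.of (lhd q.1 q.2))⁻¹ * (FreeGroup.of q.2)⁻¹ * FreeGroup.of q.1 * FreeGroup.of q.2

/-- The adjoint group `As(X) = ⟨ e_x (x ∈ X) | e_{x ⊲ y}⁻¹ e_y⁻¹ e_x e_y (x, y ∈ X) ⟩`. -/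
abbrev As (X : Type u) [Quandle X] : Type u := PresentedGroup (adjointRels X)

/-- The generator `e_x` of `As(X)`. -/
def As.e {X : Type u} [Quandle X] (x : X) : As X := PresentedGroup.of x

theorem As.e_lhd {X : Type u} [Quandle X] (x y : X) :
    As.e (lhd x y) = (As.e y)⁻¹ * As.e x * As.e y := by
  have h : (As.e (lhd x y))⁻¹ * (As.e y)⁻¹ * As.e x * As.e y = 1 :=
    PresentedGroup.one_of_mem (rels := adjointRels X) ⟨(x, y), rfl⟩
  rw [mul_assoc, mul_assoc, inv_mul_eq_one, ← mul_assoc] at h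
  exact h

/-- A map `f : X → G` into a group with `f (x ⊲ y) = (f y)⁻¹ (f x) (f y)` extends to `As(X)`. -/
def As.lift {X : Type u} [Quandle X] {G : Type v} [Group G] (f : X → G)
    (hf : ∀ x y, f (lhd x y) = (f y)⁻¹ * f x * f y) : As X →* G :=
  PresentedGroup.toGroup (f := f) (by
    rintro _ ⟨⟨x, y⟩, rfl⟩
    simp [hf, mul_assoc])

@[simp]
theorem As.lift_e {X : Type u} [Quandle X] {G : Type v} [Group G] (f : X → G)
    (hf : ∀ x y, f (lhd x y) = (f y)⁻¹ * f x * f y) (x : X) : As.lift f hf (As.e x) = f x :=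
  PresentedGroup.toGroup.of _

/-- The homomorphism `As(X) → As(Y)`, `e_x ↦ e_{f x}`, induced by a quandle homomorphism. -/
def As.map {X : Type u} {Y : Type v} [Quandle X] [Quandle Y] (f : X →◃ Y) : As X →* As Y :=
  As.lift (fun x => As.e (f x)) (fun x y => by
    rw [← As.e_lhd]
    exact congrArg As.e (ShelfHom.map_act f))

/-- The right action of `As(X)` on `X`, as a homomorphism to the opposite of the symmetric group
(whose product is "first the left factor, then the right one"). -/
def As.perm (X : Type u) [Quandle X] : As X →* (Equiv.Perm X)ᵐᵒᵖ :=
  As.lift (fun y => MulOpposite.op (Rack.act' y)) (fun x y => by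
    rw [lhd, Rack.ad_conj, ← MulOpposite.op_inv, ← MulOpposite.op_mul, ← MulOpposite.op_mul,
      mul_assoc])

/-- The right action `x · g` of `g ∈ As(X)` on `x ∈ X`, determined by `x · e_y = x ⊲ y`. -/
def ract {X : Type u} [Quandle X] (x : X) (g : As X) : X := (As.perm X g).unop x

@[simp]
theorem ract_e {X : Type u} [Quandle X] (x y : X) : ract x (As.e y) = lhd x y := by
  simp [ract, As.perm, lhd]

@[simp]
theorem ract_one {X : Type u} [Quandle X] (x : X) : ract x 1 = x := by
  simp [ract]

theorem ract_mul {X : Type u} [Quandle X] (x : X) (g h : As X) :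
    ract x (g * h) = ract (ract x g) h := by
  simp [ract]

/-- `X` is connected: the right action of `As(X)` on `X` has exactly one orbit. -/
def IsConnected (X : Type u) [Quandle X] : Prop :=
  Nonempty X ∧ ∀ x y : X, ∃ g : As X, ract x g = y

/-- The homomorphism `ε : As(X) → ℤ` with `ε(e_x) = 1` for all `x ∈ X`
(for connected `X` it is the abelianization). -/
def As.eps (X : Type u) [Quandle X] : As X →* Multiplicative ℤ :=
  As.lift (fun _ => Multiplicative.ofAdd 1) (fun _ _ => by simp)

theorem As.eps_e {X : Type u} [Quandle X] (x : X) :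
    As.eps X (As.e x) = Multiplicative.ofAdd 1 := by
  simp [As.eps]

/-- The identity `e_{x · g} = g⁻¹ e_x g`. -/
theorem As.e_ract {X : Type u} [Quandle X] (g : As X) :
    ∀ x : X, As.e (ract x g) = g⁻¹ * As.e x * g := by
  induction g using PresentedGroup.induction_on with
  | _ w =>
    induction w using FreeGroup.induction_on with
    | C1 =>
      intro x
      rw [map_one, ract_one]
      simp
    | of y =>
      intro x
      exact (congrArg As.e (ract_e x y)).trans (As.e_lhd x y)
    | inv_of y ih =>
      intro x
      rw [map_inv]
      have h := ih (ract x (PresentedGroup.mk _ (FreeGroup.of y))⁻¹)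
      rw [← ract_mul, inv_mul_cancel, ract_one] at h
      rw [h]
      group
    | mul w z ihw ihz =>
      intro x
      rw [map_mul, ract_mul, ihz, ihw]
      group

/-- The underlying set `Ker(ε) ⊆ As(X)` of the extended quandle `X̃` with base point `a ∈ X`.
The base point enters the quandle operation. -/
@[nolint unusedArguments]
def UnivCover (X : Type u) [Quandle X] (_a : X) : Type u := (As.eps X).ker

namespace UnivCover

variable {X : Type u} [Quandle X] {a : X}

/-- The element of `As(X)` underlying an element of `X̃`. -/
def val (g : UnivCover X a) : As X := Subtype.val g

theorem ext {g h : UnivCover X a} (H : val g = val h) : g = h := Subtype.ext H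

theorem eps_val (g : UnivCover X a) : As.eps X g.val = 1 := Subtype.property g

/-- The quandle operation `g ⊲ h = e_a⁻¹ g h⁻¹ e_a h` on `X̃ = Ker(ε)`. -/
def op (g h : UnivCover X a) : UnivCover X a :=
  ⟨(As.e a)⁻¹ * g.val * h.val⁻¹ * As.e a * h.val, by
    simp [MonoidHom.mem_ker, eps_val, As.eps_e]⟩

/-- The inverse of `(• ⊲ h)`: the map `g ↦ e_a g h⁻¹ e_a⁻¹ h`. -/
def invOp (g h : UnivCover X a) : UnivCover X a :=
  ⟨As.e a * g.val * h.val⁻¹ * (As.e a)⁻¹ * h.val, by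
    simp [MonoidHom.mem_ker, eps_val, As.eps_e]⟩

theorem val_op (g h : UnivCover X a) :
    (op g h).val = (As.e a)⁻¹ * g.val * h.val⁻¹ * As.e a * h.val := rfl

theorem val_invOp (g h : UnivCover X a) :
    (invOp g h).val = As.e a * g.val * h.val⁻¹ * (As.e a)⁻¹ * h.val := rfl

/-- The extended quandle `X̃` (recall that `h ◃ g` stands for `g ⊲ h`). -/
instance : Quandle (UnivCover X a) where
  act h g := op g h
  self_distrib {x y z} := ext (by simp only [val_op]; group)
  invAct h g := invOp g h
  left_inv h g := ext (by simp only [val_op, val_invOp]; group)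
  right_inv h g := ext (by simp only [val_op, val_invOp]; group)
  fix {g} := ext (by simp only [val_op]; group)

variable (X a)

/-- The universal covering `p : X̃ → X`, `p(g) = a · g`. -/
def proj : UnivCover X a →◃ X where
  toFun g := ract a g.val
  map_act' {h g} := by
    have h1 : ract a (As.e a)⁻¹ = a := by
      have h2 : ract a (As.e a) = a := by rw [ract_e, lhd, Quandle.fix]
      calc ract a (As.e a)⁻¹ = ract (ract a (As.e a)) (As.e a)⁻¹ := by rw [h2]
        _ = a := by rw [← ract_mul, mul_inv_cancel, ract_one]
    have h3 : (op g h).val = (As.e a)⁻¹ * (g.val * As.e (ract a h.val)) := by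
      rw [val_op, As.e_ract]
      group
    change ract a (op g h).val = lhd (ract a g.val) (ract a h.val)
    rw [h3, ract_mul, h1, ract_mul, ract_e]

end UnivCover

/-- The integers in the universe `u`. -/
abbrev IntU : Type u := ULift.{u} ℤ

/-- The group homology `H_n(G)` with trivial integral coefficients.  (Mathlib's `groupHomology`
wants the coefficient ring in the universe of the group.) -/
abbrev H (n : ℕ) (G : Type u) [Group G] : Type u :=
  groupHomology (Rep.trivial IntU.{u} G IntU.{u}) n

/-- The identity of the coefficients, as a map of representations over `f : G → G'`. -/
def coeffMap {G G' : Type u} [Group G] [Group G'] (f : G →* G') :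
    Rep.trivial IntU.{u} G IntU.{u} ⟶ Rep.res f (Rep.trivial IntU.{u} G' IntU.{u}) :=
  Rep.ofHom ⟨LinearMap.id, fun _ => rfl⟩

/-- The homomorphism `f_* : H_n(G) → H_n(G')` induced by a group homomorphism `f : G → G'`. -/
def H.map (n : ℕ) {G G' : Type u} [Group G] [Group G'] (f : G →* G') : H n G →+ H n G' :=
  (groupHomology.map f (coeffMap f) n).hom.toAddMonoidHom

instance isPrime_span (ℓ : ℕ) [hℓ : Fact ℓ.Prime] : (Ideal.span {(ℓ : ℤ)}).IsPrime :=
  (Ideal.span_singleton_prime (by exact_mod_cast hℓ.out.ne_zero)).2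
    (Nat.prime_iff_prime_int.1 hℓ.out)

/-- A homomorphism `f : A → B` of abelian groups is a `[1/N]`-isomorphism if for every prime `ℓ`
not dividing `N` its localization at `ℓ` (that is, at the prime ideal `(ℓ)` of `ℤ`) is an
isomorphism. -/
def IsAwayIso (N : ℕ) {A : Type u} {B : Type v} [AddCommGroup A] [AddCommGroup B]
    (f : A →+ B) : Prop :=
  ∀ (ℓ : ℕ) [Fact ℓ.Prime], ¬ ℓ ∣ N →
    Function.Bijective
      (LocalizedModule.map (Ideal.span {(ℓ : ℤ)}).primeCompl f.toIntLinearMap)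

end QuandleCovering

end

/-!
The action of `As(X̃)` on `X̃` is `x · g = e_a^{-ε(g)} x p_*(g)`, so that the kernel `K` of `p_*`
acts trivially and is central. In the connected quandle `X̃` all `e_g ^ t` coincide, so that the
differences `e_g⁻¹ e_h` with `p(g) = p(h)`, which generate `K`, satisfy `c ^ t = 1`. Hence every
finite subset of `K` lies in a finite subgroup `B`, of order prime to `ℓ` if `ℓ ∤ t`.

For such a `B`, the sum `T` over all `(g₀β₀, …, gₙβₙ)` with `βᵢ ∈ B` is homotopic on homogeneous
cycles to multiplication by `|B| ^ (n + 1)`, and it kills a given chain with image `0` in `As(X)`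
as soon as `B` is large enough. The first fact annihilates the kernel of `p_*` on homology by a
number prime to `ℓ`, and since `∂T = |B| T∂`, the second turns lifts of cycles into cycles.
-/

open Quandles

noncomputable section

universe u v w

namespace QuandleCovering

section Chains

variable (k : Type v) [CommRing k] {α : Type u} {β : Type w}

/-- The `k`-linear combinations of `n`-tuples of elements of `α`. They serve both as homogeneous
chains of dimension `n - 1` on the full simplex with vertex set `α` and, when `α` is a group, as
inhomogeneous (bar) chains of degree `n`. -/
abbrev Chain (α : Type u) (n : ℕ) : Type (max u v) := (Fin n → α) →₀ k

/-- The map of chains induced by a map of vertex sets. -/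
def Chain.map (f : α → β) (n : ℕ) : Chain k α n →ₗ[k] Chain k β n :=
  Finsupp.lmapDomain k k (f ∘ ·)

@[simp]
theorem Chain.map_single (f : α → β) {n : ℕ} (g : Fin n → α) (r : k) :
    Chain.map k f n (Finsupp.single g r) = Finsupp.single (f ∘ g) r :=
  Finsupp.mapDomain_single

theorem Chain.map_map {γ : Type*} (f : β → γ) (g : α → β) {n : ℕ} (c : Chain k α n) :
    Chain.map k f n (Chain.map k g n c) = Chain.map k (f ∘ g) n c :=
  Finsupp.mapDomain_comp.symm

theorem Chain.map_surjective {f : α → β} (hf : Function.Surjective f) {n : ℕ} :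
    Function.Surjective (Chain.map k f n) :=
  Finsupp.mapDomain_surjective hf.comp_left

/-- The boundary operator of the augmented homogeneous chain complex of `α`. -/
def boundary (α : Type u) (n : ℕ) : Chain k α (n + 1) →ₗ[k] Chain k α n :=
  Finsupp.linearCombination k fun g =>
    ∑ p : Fin (n + 1), (-1 : k) ^ (p : ℕ) • Finsupp.single (g ∘ p.succAbove) 1

theorem boundary_single {n : ℕ} (g : Fin (n + 1) → α) :
    boundary k α n (Finsupp.single g 1) =
      ∑ p : Fin (n + 1), (-1 : k) ^ (p : ℕ) • Finsupp.single (g ∘ p.succAbove) 1 := by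
  rw [boundary, Finsupp.linearCombination_single, one_smul]

theorem boundary_map (f : α → β) {n : ℕ} (c : Chain k α (n + 1)) :
    boundary k β n (Chain.map k f (n + 1) c) = Chain.map k f n (boundary k α n c) := by
  suffices boundary k β n ∘ₗ Chain.map k f (n + 1) = Chain.map k f n ∘ₗ boundary k α n from
    DFunLike.congr_fun this c
  ext g : 2
  simp [boundary_single, Function.comp_assoc]

/-- The cone `a ∗ c` with apex `a` over a chain `c`. -/
def cone (a : α) (n : ℕ) : Chain k α n →ₗ[k] Chain k α (n + 1) :=
  Finsupp.lmapDomain k k fun g => (Fin.cons a g : Fin (n + 1) → α)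

theorem cone_single (a : α) {n : ℕ} (g : Fin n → α) (r : k) :
    cone k a n (Finsupp.single g r) = Finsupp.single (Fin.cons a g : Fin (n + 1) → α) r :=
  Finsupp.mapDomain_single

theorem map_cone (f : α → β) (a : α) {n : ℕ} (c : Chain k α n) :
    Chain.map k f (n + 1) (cone k a n c) = cone k (f a) n (Chain.map k f n c) := by
  suffices Chain.map k f (n + 1) ∘ₗ cone k a n = cone k (f a) n ∘ₗ Chain.map k f n from
    DFunLike.congr_fun this c
  ext g : 2
  simp [cone_single, Fin.comp_cons]

theorem boundary_cone_zero (a : α) (c : Chain k α 0) : boundary k α 0 (cone k a 0 c) = c := by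
  suffices boundary k α 0 ∘ₗ cone k a 0 = LinearMap.id from DFunLike.congr_fun this c
  ext g : 2
  simp [cone_single, boundary_single, Subsingleton.elim _ g]

theorem boundary_cone (a : α) {n : ℕ} (c : Chain k α (n + 1)) :
    boundary k α (n + 1) (cone k a (n + 1) c) = c - cone k a n (boundary k α n c) := by
  suffices boundary k α (n + 1) ∘ₗ cone k a (n + 1) =
      LinearMap.id - cone k a n ∘ₗ boundary k α n from DFunLike.congr_fun this c
  ext g : 2
  have cons_comp_succ (p : Fin (n + 1)) :
      (Fin.cons a g : Fin (n + 2) → α) ∘ p.succ.succAbove = Fin.cons a (g ∘ p.succAbove) := by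
    ext i
    cases i using Fin.cases <;> simp
  simp [cone_single, boundary_single, Fin.sum_univ_succ (n := n + 1), cons_comp_succ,
    pow_succ, sub_eq_add_neg]

theorem hom_ext_cone {M : Type*} [AddCommGroup M] [Module k M] {n : ℕ}
    {φ ψ : Chain k α (n + 1) →ₗ[k] M}
    (h : ∀ a (c : Chain k α n), φ (cone k a n c) = ψ (cone k a n c)) : φ = ψ := by
  ext g : 2
  have hg := h (g 0) (Finsupp.single (Fin.tail g) 1)
  rwa [cone_single, Fin.cons_self_tail] at hg

end Chains

section CosetSum

theorem sum_comp_succAbove {M : Type*} [AddCommMonoid M] {ι : Type*} [Fintype ι] {n : ℕ}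
    (p : Fin (n + 1)) (F : (Fin n → ι) → M) :
    ∑ b : Fin (n + 1) → ι, F (b ∘ p.succAbove) = Fintype.card ι • ∑ b, F b := by
  rw [← (Fin.insertNthEquiv (fun _ => ι) p).sum_comp, Fintype.sum_prod_type]
  simp [Function.comp_def]

variable (k : Type v) [CommRing k] {G : Type u} [Group G] (B : Subgroup G) [Fintype B]

/-- The sum over all tuples `(g₀β₀, …, gₙβₙ)` with entries `βᵢ` in a finite subgroup `B`. -/
def cosetSum (n : ℕ) : Chain k G n →ₗ[k] Chain k G n :=
  Finsupp.linearCombination k fun g =>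
    ∑ b : Fin n → B, Finsupp.single (fun i => g i * b i) 1

theorem cosetSum_single {n : ℕ} (g : Fin n → G) :
    cosetSum k B n (Finsupp.single g 1) =
      ∑ b : Fin n → B, Finsupp.single (fun i => g i * b i) 1 := by
  rw [cosetSum, Finsupp.linearCombination_single, one_smul]

theorem cosetSum_zero (c : Chain k G 0) : cosetSum k B 0 c = c := by
  suffices cosetSum k B 0 = LinearMap.id from DFunLike.congr_fun this c
  ext g : 2
  simp [cosetSum_single, Subsingleton.elim _ g]

theorem boundary_cosetSum {n : ℕ} (c : Chain k G (n + 1)) :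
    boundary k G n (cosetSum k B (n + 1) c) =
      Fintype.card B • cosetSum k B n (boundary k G n c) := by
  suffices boundary k G n ∘ₗ cosetSum k B (n + 1) =
      Fintype.card B • cosetSum k B n ∘ₗ boundary k G n from DFunLike.congr_fun this c
  ext g : 2
  simp only [LinearMap.comp_apply, Finsupp.lsingle_apply, LinearMap.smul_apply, cosetSum_single,
    boundary_single, map_sum, map_smul, Finset.smul_sum]
  rw [Finset.sum_comm]
  refine Finset.sum_congr rfl fun p _ => ?_
  simp only [← Finset.smul_sum]
  rw [smul_comm, ← sum_comp_succAbove p]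
  rfl

theorem map_mul_left_cosetSum (x : G) {n : ℕ} (c : Chain k G n) :
    Chain.map k (x * ·) n (cosetSum k B n c) = cosetSum k B n (Chain.map k (x * ·) n c) := by
  suffices Chain.map k (x * ·) n ∘ₗ cosetSum k B n = cosetSum k B n ∘ₗ Chain.map k (x * ·) n from
    DFunLike.congr_fun this c
  ext g : 2
  simp [cosetSum_single, Function.comp_def, mul_assoc]

theorem map_cosetSum {Q : Type w} [Group Q] {f : G →* Q} (hB : B ≤ f.ker) {n : ℕ}
    (c : Chain k G n) :
    Chain.map k f n (cosetSum k B n c) = Fintype.card B ^ n • Chain.map k f n c := by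
  suffices Chain.map k f n ∘ₗ cosetSum k B n = Fintype.card B ^ n • Chain.map k f n from
    DFunLike.congr_fun this c
  ext g : 2
  have hf (b : B) : f b = 1 := hB b.2
  simp [cosetSum_single, Function.comp_def, hf]

theorem cosetSum_single_congr {n : ℕ} {g h : Fin n → G} (hgh : ∀ i, (g i)⁻¹ * h i ∈ B) :
    cosetSum k B n (Finsupp.single g 1) = cosetSum k B n (Finsupp.single h 1) := by
  rw [cosetSum_single, cosetSum_single]
  refine (Fintype.sum_equiv (Equiv.piCongrRight fun i => Equiv.mulLeft ⟨_, hgh i⟩) _ _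
    fun b => ?_).symm
  simp [mul_assoc]

/-- The homotopy from `cosetSum` to multiplication by a power of the order of `B`. It cones off
over the first vertex and corrects the result on the opposite face recursively. -/
def prism : (n : ℕ) → Chain k G n →ₗ[k] Chain k G (n + 1)
  | 0 => 0
  | n + 1 => Finsupp.linearCombination k fun g =>
      cone k (g 0) (n + 1) (cosetSum k B (n + 1) (Finsupp.single g 1)) -
        Fintype.card B • cone k (g 0) (n + 1) (prism n (Finsupp.single (Fin.tail g) 1))

theorem prism_zero (c : Chain k G 0) : prism k B 0 c = 0 := rfl

theorem prism_cone (a : G) {n : ℕ} (c : Chain k G n) :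
    prism k B (n + 1) (cone k a n c) =
      cone k a (n + 1) (cosetSum k B (n + 1) (cone k a n c)) -
        Fintype.card B • cone k a (n + 1) (prism k B n c) := by
  suffices prism k B (n + 1) ∘ₗ cone k a n =
      cone k a (n + 1) ∘ₗ cosetSum k B (n + 1) ∘ₗ cone k a n -
        Fintype.card B • cone k a (n + 1) ∘ₗ prism k B n from DFunLike.congr_fun this c
  ext g : 2
  simp [prism, cone_single]

theorem boundary_prism {n : ℕ} (c : Chain k G (n + 1)) :
    boundary k G (n + 1) (prism k B (n + 1) c) +
        Fintype.card B • prism k B n (boundary k G n c) =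
      cosetSum k B (n + 1) c - Fintype.card B ^ (n + 1) • c := by
  suffices boundary k G (n + 1) ∘ₗ prism k B (n + 1) +
      Fintype.card B • prism k B n ∘ₗ boundary k G n =
        cosetSum k B (n + 1) - Fintype.card B ^ (n + 1) • LinearMap.id from
    DFunLike.congr_fun this c
  clear c
  induction n with
  | zero =>
    refine hom_ext_cone k fun a c => ?_
    simp [prism_cone, prism_zero, boundary_cone, boundary_cosetSum, boundary_cone_zero,
      cosetSum_zero]
  | succ n ih =>
    refine hom_ext_cone k fun a c => ?_
    have ihc := congrArg (cone k a (n + 1)) (DFunLike.congr_fun ih c)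
    simp only [LinearMap.add_apply, LinearMap.comp_apply, LinearMap.smul_apply,
      LinearMap.sub_apply, LinearMap.id_apply, map_add, map_sub, map_nsmul] at ihc ⊢
    rw [← sub_eq_zero] at ihc ⊢
    simp only [prism_cone, boundary_cone, boundary_cosetSum, map_sub, map_nsmul]
    rw [← smul_zero (Fintype.card B), ← ihc]
    module

theorem map_mul_left_prism (x : G) {n : ℕ} (c : Chain k G n) :
    Chain.map k (x * ·) (n + 1) (prism k B n c) = prism k B n (Chain.map k (x * ·) n c) := by
  suffices Chain.map k (x * ·) (n + 1) ∘ₗ prism k B n = prism k B n ∘ₗ Chain.map k (x * ·) n from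
    DFunLike.congr_fun this c
  clear c
  induction n with
  | zero => rfl
  | succ n ih =>
    refine hom_ext_cone k fun a c => ?_
    have ihc := DFunLike.congr_fun ih c
    simp only [LinearMap.comp_apply] at ihc ⊢
    simp only [map_cone, prism_cone, map_sub, map_nsmul, map_mul_left_cosetSum, ihc]

end CosetSum

section LocallyFinite

/-- For a prime `ℓ`: `A` is a locally finite group without elements of order `ℓ`. It is phrased in
terms of the finite subgroups over which chains are averaged. -/
def IsLocallyFinitePrimeTo {G : Type u} [Group G] (ℓ : ℕ) (A : Subgroup G) : Prop :=
  ∀ S : Set G, S.Finite → S ⊆ A → ∃ B ≤ A, S ⊆ B ∧ Finite B ∧ ¬ ℓ ∣ Nat.card B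

open scoped IsMulCommutative in
theorem isLocallyFinitePrimeTo_of_le_center {G : Type u} [Group G] {A : Subgroup G}
    (hA : A ≤ Subgroup.center G) {t : ℕ} (ht : ∀ c ∈ A, c ^ t = 1) {ℓ : ℕ} (hℓ : ℓ.Prime)
    (hℓt : ¬ ℓ ∣ t) : IsLocallyFinitePrimeTo ℓ A := by
  intro S hS hSA
  have hB : Subgroup.closure S ≤ A := (Subgroup.closure_le A).2 hSA
  have pow_eq_one (x : Subgroup.closure S) : x ^ t = 1 := Subtype.ext (ht _ (hB x.2))
  have t_pos : 0 < t := Nat.pos_of_ne_zero fun h => hℓt (h ▸ dvd_zero ℓ)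
  have : IsMulCommutative (Subgroup.closure S) := .of_comm fun x y =>
    Subtype.ext (Subgroup.mem_center_iff.1 (hA (hB y.2)) x)
  have : Group.FG (Subgroup.closure S) :=
    (Group.fg_iff_subgroup_fg _).2 ((Subgroup.fg_iff _).2 ⟨S, rfl, hS⟩)
  have : Finite (Subgroup.closure S) := CommGroup.finite_of_fg_isMulTorsion _ fun x =>
    isOfFinOrder_iff_pow_eq_one.2 ⟨t, t_pos, pow_eq_one x⟩
  refine ⟨_, hB, Subgroup.subset_closure, this, fun hdvd => hℓt ?_⟩
  have := Fact.mk hℓ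
  obtain ⟨x, rfl⟩ := exists_prime_orderOf_dvd_card' ℓ hdvd
  exact orderOf_dvd_of_pow_eq_one (pow_eq_one x)

end LocallyFinite

section Vanishing

variable (k : Type v) [CommRing k] {G : Type u} {Q : Type w} [Group G] [Group Q]

theorem cosetSum_map (B : Subgroup G) [Fintype B] (r : G → G) {n : ℕ} {c : Chain k G n}
    (hr : ∀ g ∈ c.support, ∀ i, (g i)⁻¹ * r (g i) ∈ B) :
    cosetSum k B n (Chain.map k r n c) = cosetSum k B n c := by
  rw [← Finsupp.sum_single c]
  simp only [Finsupp.sum, map_sum, Chain.map_single]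
  refine Finset.sum_congr rfl fun g hg => ?_
  rw [← mul_one (c g), ← smul_eq_mul, ← Finsupp.smul_single, ← Finsupp.smul_single, map_smul,
    map_smul]
  exact congrArg (c g • ·) (cosetSum_single_congr k B (hr g hg)).symm

theorem exists_cosetSum_eq_zero {f : G →* Q} (hf : Function.Surjective f) {ℓ : ℕ}
    (hker : IsLocallyFinitePrimeTo ℓ f.ker) {n : ℕ} {c : Chain k G n} (hc : Chain.map k f n c = 0) :
    ∃ B ≤ f.ker, ∃ _ : Fintype B, ¬ ℓ ∣ Fintype.card B ∧ cosetSum k B n c = 0 := by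
  obtain ⟨s, hs⟩ := hf.hasRightInverse
  -- `B` is chosen such that `s ∘ f` moves the vertices of `c` only within their cosets of `B`.
  let S : Set G := ⋃ g ∈ c.support, Set.range fun i => (g i)⁻¹ * s (f (g i))
  have S_finite : S.Finite := c.support.finite_toSet.biUnion fun g _ => Set.finite_range _
  have S_le : S ⊆ f.ker := by
    simp only [S, Set.iUnion_subset_iff]
    rintro g - _ ⟨i, rfl⟩
    simp [MonoidHom.mem_ker, hs (f (g i))]
  obtain ⟨B, hB, hSB, B_finite, hℓB⟩ := hker S S_finite S_le
  have := Fintype.ofFinite B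
  refine ⟨B, hB, this, by rwa [← Nat.card_eq_fintype_card], ?_⟩
  have hr : ∀ g ∈ c.support, ∀ i, (g i)⁻¹ * (s ∘ f) (g i) ∈ B := fun g hg i =>
    hSB (Set.mem_biUnion hg ⟨i, rfl⟩)
  rw [← cosetSum_map k B (s ∘ f) hr, ← Chain.map_map, hc, map_zero, map_zero]

end Vanishing

section Bar

variable (k : Type v) [CommRing k] {G : Type u} [Group G]

/-- The bar chain of a homogeneous chain: `(g₀, …, gₙ)` becomes `[g₀⁻¹g₁ | ⋯ | gₙ₋₁⁻¹gₙ]`. -/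
def dehomogenize (n : ℕ) : Chain k G (n + 1) →ₗ[k] Chain k G n :=
  Finsupp.lmapDomain k k fun g i => (g i.castSucc)⁻¹ * g i.succ

/-- The homogeneous chain with all first vertices `1` of a bar chain: `[x₁ | ⋯ | xₙ]` becomes
`(1, x₁, x₁x₂, …, x₁⋯xₙ)`. -/
def homogenize (n : ℕ) : Chain k G n →ₗ[k] Chain k G (n + 1) :=
  Finsupp.lmapDomain k k Fin.partialProd

theorem dehomogenize_single {n : ℕ} (g : Fin (n + 1) → G) (r : k) :
    dehomogenize k n (Finsupp.single g r) =
      Finsupp.single (fun i => (g i.castSucc)⁻¹ * g i.succ) r :=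
  Finsupp.mapDomain_single

theorem homogenize_single {n : ℕ} (x : Fin n → G) (r : k) :
    homogenize k n (Finsupp.single x r) = Finsupp.single (Fin.partialProd x) r :=
  Finsupp.mapDomain_single

theorem dehomogenize_homogenize {n : ℕ} (c : Chain k G n) :
    dehomogenize k n (homogenize k n c) = c := by
  suffices dehomogenize k n ∘ₗ homogenize k n = LinearMap.id from DFunLike.congr_fun this c
  ext x : 2
  simp [homogenize_single, dehomogenize_single, Fin.partialProd_right_inv]

theorem dehomogenize_map {Q : Type w} [Group Q] (f : G →* Q) {n : ℕ} (c : Chain k G (n + 1)) :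
    dehomogenize k n (Chain.map k f (n + 1) c) = Chain.map k f n (dehomogenize k n c) := by
  suffices dehomogenize k n ∘ₗ Chain.map k f (n + 1) = Chain.map k f n ∘ₗ dehomogenize k n from
    DFunLike.congr_fun this c
  ext g : 2
  simp [dehomogenize_single, Function.comp_def]

theorem homogenize_map {Q : Type w} [Group Q] (f : G →* Q) {n : ℕ} (c : Chain k G n) :
    homogenize k n (Chain.map k f n c) = Chain.map k f (n + 1) (homogenize k n c) := by
  suffices homogenize k n ∘ₗ Chain.map k f n = Chain.map k f (n + 1) ∘ₗ homogenize k n from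
    DFunLike.congr_fun this c
  ext x : 2
  have partialProd_comp : Fin.partialProd (f ∘ x) = f ∘ Fin.partialProd x := by
    ext i
    simp [Fin.partialProd, map_list_prod, List.map_take, List.map_ofFn]
  simp [homogenize_single, partialProd_comp]

/-- The linear map `φ` commutes with left translations of the vertices. -/
def IsTranslationEquivariant {m n : ℕ} (φ : Chain k G m →ₗ[k] Chain k G n) : Prop :=
  ∀ (x : G) c, Chain.map k (x * ·) n (φ c) = φ (Chain.map k (x * ·) m c)

theorem dehomogenize_map_mul_left (x : G) {n : ℕ} (c : Chain k G (n + 1)) :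
    dehomogenize k n (Chain.map k (x * ·) (n + 1) c) = dehomogenize k n c := by
  suffices dehomogenize k n ∘ₗ Chain.map k (x * ·) (n + 1) = dehomogenize k n from
    DFunLike.congr_fun this c
  ext g : 2
  simp [dehomogenize_single, mul_assoc]

theorem IsTranslationEquivariant.dehomogenize_apply {m n : ℕ}
    {φ : Chain k G (m + 1) →ₗ[k] Chain k G (n + 1)} (hφ : IsTranslationEquivariant k φ)
    (c : Chain k G (m + 1)) :
    dehomogenize k n (φ (homogenize k m (dehomogenize k m c))) = dehomogenize k n (φ c) := by
  suffices dehomogenize k n ∘ₗ φ ∘ₗ homogenize k m ∘ₗ dehomogenize k m =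
      dehomogenize k n ∘ₗ φ from DFunLike.congr_fun this c
  ext g : 2
  have h : Chain.map k (g 0 * ·) (m + 1)
      (homogenize k m (dehomogenize k m (Finsupp.single g 1))) = Finsupp.single g 1 := by
    rw [dehomogenize_single, homogenize_single, Chain.map_single]
    exact congrArg (Finsupp.single · 1) (Fin.partialProd_left_inv g)
  simp only [LinearMap.comp_apply, Finsupp.lsingle_apply]
  rw [← dehomogenize_map_mul_left k (g 0), hφ, h]

end Bar

section BarComplex

variable (k : Type u) [CommRing k] {G Q : Type u} [Group G] [Group Q]

/-- The differential of the inhomogeneous bar complex of `G` with trivial coefficients `k`. -/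
def barD (G : Type u) [Group G] (n : ℕ) : Chain k G (n + 1) →ₗ[k] Chain k G n :=
  (groupHomology.inhomogeneousChains.d (Rep.trivial k G k) n).hom

theorem barD_single {n : ℕ} (x : Fin (n + 1) → G) (r : k) :
    barD k G n (Finsupp.single x r) = Finsupp.single (fun i => x i.succ) r +
      ∑ j : Fin (n + 1),
        (-1 : k) ^ ((j : ℕ) + 1) • Finsupp.single (Fin.contractNth j (· * ·) x) r :=
  groupHomology.inhomogeneousChains.d_single (A := Rep.trivial k G k) n x r

theorem barD_eq_dehomogenize {n : ℕ} (c : Chain k G (n + 1)) :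
    barD k G n c = dehomogenize k n (boundary k G (n + 1) (homogenize k (n + 1) c)) := by
  suffices barD k G n = dehomogenize k n ∘ₗ boundary k G (n + 1) ∘ₗ homogenize k (n + 1) from
    DFunLike.congr_fun this c
  ext x : 2
  have tail_apply (i : Fin n) :
      (Fin.partialProd x i.castSucc.succ)⁻¹ * Fin.partialProd x i.succ.succ = x i.succ :=
    Fin.partialProd_right_inv x i.succ
  simp [barD_single, homogenize_single, boundary_single, Fin.sum_univ_succ (n := n + 1),
    ← Fin.partialProd_contractNth, dehomogenize_single, Fin.partialProd_right_inv, tail_apply]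

theorem barD_dehomogenize {n : ℕ} (c : Chain k G (n + 2)) :
    barD k G n (dehomogenize k (n + 1) c) = dehomogenize k n (boundary k G (n + 1) c) := by
  have hd : IsTranslationEquivariant k (boundary k G (n + 1)) := fun x c =>
    (boundary_map k (x * ·) c).symm
  rw [barD_eq_dehomogenize, hd.dehomogenize_apply]

theorem barD_map (f : G →* Q) {n : ℕ} (c : Chain k G (n + 1)) :
    barD k Q n (Chain.map k f (n + 1) c) = Chain.map k f n (barD k G n c) := by
  rw [barD_eq_dehomogenize, homogenize_map, boundary_map, dehomogenize_map, barD_eq_dehomogenize]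

theorem barD_barD {n : ℕ} (c : Chain k G (n + 2)) : barD k G n (barD k G (n + 1) c) = 0 :=
  DFunLike.congr_fun (congrArg ModuleCat.Hom.hom
    (groupHomology.inhomogeneousChains.d_comp_d (Rep.trivial k G k) (n := n))) c

/-- The cycles of degree `n` of the inhomogeneous bar complex. -/
def barCycles (G : Type u) [Group G] : (n : ℕ) → Submodule k (Chain k G n)
  | 0 => ⊤
  | n + 1 => LinearMap.ker (barD k G n)

theorem barD_mem_barCycles {n : ℕ} (c : Chain k G (n + 1)) : barD k G n c ∈ barCycles k G n :=
  match n with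
  | 0 => Submodule.mem_top
  | _ + 1 => LinearMap.mem_ker.2 (barD_barD k c)

theorem barD_dehomogenize_prism (B : Subgroup G) [Fintype B] {n : ℕ} {z : Chain k G n}
    (hz : z ∈ barCycles k G n) :
    barD k G n (dehomogenize k (n + 1) (prism k B (n + 1) (homogenize k n z))) =
      dehomogenize k n (cosetSum k B (n + 1) (homogenize k n z)) -
        Fintype.card B ^ (n + 1) • z := by
  have prism_boundary : dehomogenize k n (prism k B n (boundary k G n (homogenize k n z))) = 0 := by
    cases n with
    | zero => rw [prism_zero, map_zero]
    | succ n =>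
      have hB : IsTranslationEquivariant k (prism k B (n + 1)) := fun x _ =>
        map_mul_left_prism k B x _
      rw [← hB.dehomogenize_apply, ← barD_eq_dehomogenize, LinearMap.mem_ker.1 hz]
      simp only [map_zero]
  have homotopy := congrArg (dehomogenize k n) (boundary_prism k B (homogenize k n z))
  rwa [map_add, map_sub, map_nsmul, map_nsmul, prism_boundary, smul_zero, add_zero,
    dehomogenize_homogenize, ← barD_dehomogenize] at homotopy

theorem barD_dehomogenize_cosetSum (B : Subgroup G) [Fintype B] {n : ℕ} (c : Chain k G (n + 1)) :
    barD k G n (dehomogenize k (n + 1) (cosetSum k B (n + 2) (homogenize k (n + 1) c))) =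
      Fintype.card B •
        dehomogenize k n (cosetSum k B (n + 1) (homogenize k n (barD k G n c))) := by
  have hB : IsTranslationEquivariant k (cosetSum k B (n + 1)) := fun x _ =>
    map_mul_left_cosetSum k B x _
  rw [barD_dehomogenize, boundary_cosetSum, map_nsmul, barD_eq_dehomogenize, hB.dehomogenize_apply]

theorem map_dehomogenize_cosetSum {f : G →* Q} {B : Subgroup G} [Fintype B] (hB : B ≤ f.ker)
    {n : ℕ} (c : Chain k G n) :
    Chain.map k f n (dehomogenize k n (cosetSum k B (n + 1) (homogenize k n c))) =
      Fintype.card B ^ (n + 1) • Chain.map k f n c := by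
  rw [← dehomogenize_map, map_cosetSum k B hB, map_nsmul, dehomogenize_map,
    dehomogenize_homogenize]

theorem exists_barD_eq_smul {f : G →* Q} (hf : Function.Surjective f) {ℓ : ℕ} (hℓ : ℓ.Prime)
    (hker : IsLocallyFinitePrimeTo ℓ f.ker) {n : ℕ} {z : Chain k G n} (hz : z ∈ barCycles k G n)
    {w : Chain k Q (n + 1)} (hw : barD k Q n w = Chain.map k f n z) :
    ∃ m : ℕ, ¬ ℓ ∣ m ∧ ∃ v, barD k G n v = m • z := by
  obtain ⟨w, rfl⟩ := Chain.map_surjective k hf w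
  have hz' : z - barD k G n w ∈ barCycles k G n := sub_mem hz (barD_mem_barCycles k w)
  have map_eq_zero : Chain.map k f (n + 1) (homogenize k n (z - barD k G n w)) = 0 := by
    rw [← homogenize_map, map_sub, ← barD_map, hw, sub_self, map_zero]
  obtain ⟨B, -, _, hℓB, hB⟩ := exists_cosetSum_eq_zero k hf hker map_eq_zero
  have homotopy := barD_dehomogenize_prism k B hz'
  refine ⟨Fintype.card B ^ (n + 1), mt hℓ.dvd_of_dvd_pow hℓB, Fintype.card B ^ (n + 1) • w -
    dehomogenize k (n + 1) (prism k B (n + 1) (homogenize k n (z - barD k G n w))), ?_⟩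
  rw [map_sub, map_nsmul, homotopy, hB, map_zero]
  module

theorem exists_map_eq_smul {f : G →* Q} (hf : Function.Surjective f) {ℓ : ℕ} (hℓ : ℓ.Prime)
    (hker : IsLocallyFinitePrimeTo ℓ f.ker) {n : ℕ} {z : Chain k Q n} (hz : z ∈ barCycles k Q n) :
    ∃ m : ℕ, ¬ ℓ ∣ m ∧ ∃ y ∈ barCycles k G n, Chain.map k f n y = m • z := by
  obtain ⟨c, rfl⟩ := Chain.map_surjective k hf z
  cases n with
  | zero => exact ⟨1, hℓ.one_lt.ne' ∘ Nat.dvd_one.1, c, Submodule.mem_top, (one_smul _ _).symm⟩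
  | succ n =>
    have map_eq_zero : Chain.map k f (n + 1) (homogenize k n (barD k G n c)) = 0 := by
      rw [← homogenize_map, ← barD_map, LinearMap.mem_ker.1 hz, map_zero]
    obtain ⟨B, hBf, _, hℓB, hB⟩ := exists_cosetSum_eq_zero k hf hker map_eq_zero
    refine ⟨Fintype.card B ^ (n + 2), mt hℓ.dvd_of_dvd_pow hℓB, _, LinearMap.mem_ker.2 ?_,
      map_dehomogenize_cosetSum k hBf c⟩
    rw [barD_dehomogenize_cosetSum, hB, map_zero, smul_zero]

end BarComplex

section Localization

variable {R : Type*} [CommRing R] (S : Submonoid R) {A B : Type*} [AddCommGroup A] [AddCommGroup B]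

theorem localizedMap_injective [Module R A] [Module R B] (f : A →ₗ[R] B)
    (hf : ∀ x, f x = 0 → ∃ s : S, s • x = 0) : Function.Injective (LocalizedModule.map S f) := by
  refine LinearMap.ker_eq_bot.1 (eq_bot_iff.2 fun x hx => ?_)
  obtain ⟨y, hy, s, rfl⟩ := (LinearMap.ker_localizedMap_eq_localized₀_ker S _ _ f).le hx
  exact (IsLocalizedModule.mk'_eq_zero' _ s).2 (hf y hy)

theorem localizedMap_surjective [Module R A] [Module R B] (f : A →ₗ[R] B)
    (hf : ∀ y, ∃ (s : S) (x : A), f x = s • y) : Function.Surjective (LocalizedModule.map S f) := by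
  refine LinearMap.range_eq_top.1 (eq_top_iff.2 fun y _ => ?_)
  refine (LinearMap.range_localizedMap_eq_localized₀_range S _ _ f).ge ?_
  obtain ⟨⟨y, t⟩, rfl⟩ :=
    IsLocalizedModule.mk'_surjective S (LocalizedModule.mkLinearMap S B) y
  obtain ⟨s, x, hx⟩ := hf y
  exact ⟨s • y, ⟨x, hx⟩, s * t, IsLocalizedModule.mk'_cancel_left _ y s t⟩

theorem isAwayIso_of_exists_nsmul {N : ℕ} (f : A →+ B)
    (hker : ∀ ℓ : ℕ, ℓ.Prime → ¬ ℓ ∣ N → ∀ x, f x = 0 → ∃ m : ℕ, ¬ ℓ ∣ m ∧ m • x = 0)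
    (hcoker : ∀ ℓ : ℕ, ℓ.Prime → ¬ ℓ ∣ N → ∀ y, ∃ m : ℕ, ¬ ℓ ∣ m ∧ ∃ x, f x = m • y) :
    IsAwayIso N f := by
  intro ℓ hℓ hN
  have mem_primeCompl {m : ℕ} (hm : ¬ ℓ ∣ m) : (m : ℤ) ∈ (Ideal.span {(ℓ : ℤ)}).primeCompl := by
    change (m : ℤ) ∉ Ideal.span {(ℓ : ℤ)}
    rwa [Ideal.mem_span_singleton, Int.natCast_dvd_natCast]
  refine ⟨localizedMap_injective _ _ fun x hx => ?_, localizedMap_surjective _ _ fun y => ?_⟩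
  · obtain ⟨m, hm, hmx⟩ := hker ℓ hℓ.out hN x hx
    exact ⟨⟨m, mem_primeCompl hm⟩, (natCast_zsmul x m).trans hmx⟩
  · obtain ⟨m, hm, x, hx⟩ := hcoker ℓ hℓ.out hN y
    exact ⟨⟨m, mem_primeCompl hm⟩, x, hx.trans (natCast_zsmul y m).symm⟩

end Localization

section Homology

open CategoryTheory

section Complex

variable {R : Type u} [CommRing R] {ι : Type v} {c : ComplexShape ι}
  {K L : HomologicalComplex (ModuleCat.{u} R) c}

theorem homologyπ_eq_zero_iff {j : ι} (y : K.cycles j) :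
    K.homologyπ j y = 0 ↔ ∃ w : K.X (c.prev j), K.d (c.prev j) j w = K.iCycles j y := by
  have hι : Function.Injective (K.homologyι j) := (ModuleCat.mono_iff_injective _).1 inferInstance
  have π_ι : K.homologyι j (K.homologyπ j y) = K.pOpcycles j (K.iCycles j y) :=
    congrArg (fun φ => φ.hom y) (K.homology_π_ι j)
  rw [← map_eq_zero_iff _ hι, π_ι]
  exact (K.sc j).moduleCat_pOpcycles_eq_zero_iff _

theorem isAwayIso_homologyMap (φ : K ⟶ L) (j : ι) {N : ℕ}
    (hker : ∀ ℓ : ℕ, ℓ.Prime → ¬ ℓ ∣ N → ∀ z : K.X j, K.d j (c.next j) z = 0 →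
      ∀ w : L.X (c.prev j), L.d (c.prev j) j w = φ.f j z →
        ∃ m : ℕ, ¬ ℓ ∣ m ∧ ∃ v : K.X (c.prev j), K.d (c.prev j) j v = m • z)
    (hcoker : ∀ ℓ : ℕ, ℓ.Prime → ¬ ℓ ∣ N → ∀ z : L.X j, L.d j (c.next j) z = 0 →
      ∃ m : ℕ, ¬ ℓ ∣ m ∧ ∃ y : K.X j, K.d j (c.next j) y = 0 ∧ φ.f j y = m • z) :
    IsAwayIso N (HomologicalComplex.homologyMap φ j).hom.toAddMonoidHom := by
  have π_surjective (K : HomologicalComplex (ModuleCat.{u} R) c) :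
      Function.Surjective (K.homologyπ j) := (ModuleCat.epi_iff_surjective _).1 inferInstance
  have iCycles_injective : Function.Injective (L.iCycles j) :=
    (ModuleCat.mono_iff_injective _).1 inferInstance
  have d_iCycles {K : HomologicalComplex (ModuleCat.{u} R) c} (y : K.cycles j) :
      K.d j (c.next j) (K.iCycles j y) = 0 :=
    congrArg (fun ψ => ψ.hom y) (K.iCycles_d j (c.next j))
  have map_π (y : K.cycles j) : (HomologicalComplex.homologyMap φ j).hom (K.homologyπ j y) =
      L.homologyπ j (HomologicalComplex.cyclesMap φ j y) :=
    congrArg (fun ψ => ψ.hom y) (HomologicalComplex.homologyπ_naturality φ j)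
  have iCycles_map (y : K.cycles j) :
      L.iCycles j (HomologicalComplex.cyclesMap φ j y) = φ.f j (K.iCycles j y) :=
    congrArg (fun ψ => ψ.hom y) (HomologicalComplex.cyclesMap_i φ j)
  refine isAwayIso_of_exists_nsmul _ (fun ℓ hℓ hN x hx => ?_) (fun ℓ hℓ hN x => ?_)
  · obtain ⟨z, rfl⟩ := π_surjective K x
    obtain ⟨w, hw⟩ := (homologyπ_eq_zero_iff _).1 ((map_π z).symm.trans hx)
    obtain ⟨m, hm, v, hv⟩ := hker ℓ hℓ hN _ (d_iCycles z) w (hw.trans (iCycles_map z))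
    refine ⟨m, hm, ?_⟩
    rw [← map_nsmul]
    exact (homologyπ_eq_zero_iff _).2 ⟨v, hv.trans (map_nsmul _ m z).symm⟩
  · obtain ⟨z, rfl⟩ := π_surjective L x
    obtain ⟨m, hm, y, hy, hyz⟩ := hcoker ℓ hℓ hN _ (d_iCycles z)
    refine ⟨m, hm, K.homologyπ j (K.cyclesMk y _ rfl hy), ?_⟩
    have iCycles_mk : K.iCycles j (K.cyclesMk y _ rfl hy) = y := K.i_cyclesMk y _ rfl hy
    refine (map_π _).trans ?_
    rw [← map_nsmul]
    refine congrArg (L.homologyπ j) (iCycles_injective ?_)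
    rw [iCycles_map, iCycles_mk, hyz, map_nsmul]

end Complex

theorem inhomogeneousChains_d_eq_barD {G : Type u} [Group G] {n : ℕ}
    (c : Chain IntU.{u} G (n + 1)) :
    (groupHomology.inhomogeneousChains (Rep.trivial IntU.{u} G IntU.{u})).d (n + 1) n c =
      barD IntU G n c := by
  rw [groupHomology.inhomogeneousChains.d_def]
  rfl

theorem inhomogeneousChains_d_eq_zero_iff {G : Type u} [Group G] {n : ℕ} {j : ℕ}
    (hj : (ComplexShape.down ℕ).next n = j) {z : Chain IntU.{u} G n} :
    (groupHomology.inhomogeneousChains (Rep.trivial IntU.{u} G IntU.{u})).d n j z = 0 ↔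
      z ∈ barCycles IntU G n := by
  cases n with
  | zero =>
    refine iff_of_true ?_ Submodule.mem_top
    rw [HomologicalComplex.shape _ _ _ (by simp)]
    rfl
  | succ n =>
    obtain rfl : n = j := by simpa using hj
    rw [inhomogeneousChains_d_eq_barD]
    rfl

theorem chainsMap_eq_map {G Q : Type u} [Group G] [Group Q] (f : G →* Q) {n : ℕ}
    (c : Chain IntU.{u} G n) :
    (groupHomology.chainsMap f (coeffMap f)).f n c = Chain.map IntU f n c := by
  suffices ((groupHomology.chainsMap f (coeffMap f)).f n).hom = Chain.map IntU f n from
    DFunLike.congr_fun this c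
  refine Finsupp.lhom_ext fun g r => ?_
  rw [Chain.map_single]
  exact groupHomology.chainsMap_f_single f (coeffMap f) n g r

theorem isAwayIso_H_map {G Q : Type u} [Group G] [Group Q] {f : G →* Q}
    (hf : Function.Surjective f) {N : ℕ}
    (hker : ∀ ℓ : ℕ, ℓ.Prime → ¬ ℓ ∣ N → IsLocallyFinitePrimeTo ℓ f.ker) (n : ℕ) :
    IsAwayIso N (H.map n f) := by
  refine isAwayIso_homologyMap _ n (fun ℓ hℓ hN z hz => ?_) (fun ℓ hℓ hN z hz => ?_)
  · rw [inhomogeneousChains_d_eq_zero_iff rfl] at hz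
    rw [ChainComplex.prev, chainsMap_eq_map]
    intro w hw
    rw [inhomogeneousChains_d_eq_barD] at hw
    obtain ⟨m, hm, v, hv⟩ := exists_barD_eq_smul IntU hf hℓ (hker ℓ hℓ hN) hz hw
    exact ⟨m, hm, v, (inhomogeneousChains_d_eq_barD v).trans hv⟩
  · rw [inhomogeneousChains_d_eq_zero_iff rfl] at hz
    obtain ⟨m, hm, y, hy, hyz⟩ := exists_map_eq_smul IntU hf hℓ (hker ℓ hℓ hN) hz
    exact ⟨m, hm, y, (inhomogeneousChains_d_eq_zero_iff rfl).2 hy,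
      (chainsMap_eq_map f y).trans hyz⟩

end Homology

section AdjointGroup

variable {X : Type u} {Y : Type v} [Quandle X] [Quandle Y]

theorem As.hom_ext {G : Type w} [Group G] {φ ψ : As X →* G}
    (h : ∀ x, φ (As.e x) = ψ (As.e x)) : φ = ψ :=
  PresentedGroup.ext h

theorem As.closure_range_e (X : Type u) [Quandle X] :
    Subgroup.closure (Set.range (As.e : X → As X)) = ⊤ :=
  PresentedGroup.closure_range_of _

@[simp]
theorem As.map_e (f : X →◃ Y) (x : X) : As.map f (As.e x) = As.e (f x) :=
  As.lift_e _ _ x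

theorem As.eps_map (f : X →◃ Y) (g : As X) : As.eps Y (As.map f g) = As.eps X g := by
  suffices (As.eps Y).comp (As.map f) = As.eps X from DFunLike.congr_fun this g
  exact As.hom_ext fun x => by rw [MonoidHom.comp_apply, As.map_e, As.eps_e, As.eps_e]

theorem As.map_surjective {f : X →◃ Y} (hf : Function.Surjective f) :
    Function.Surjective (As.map f) := by
  rw [← MonoidHom.range_eq_top, eq_top_iff, ← As.closure_range_e, Subgroup.closure_le]
  rintro _ ⟨y, rfl⟩
  obtain ⟨x, rfl⟩ := hf y
  exact ⟨As.e x, As.map_e f x⟩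

theorem As.ker_map_le {f : X →◃ Y} (hf : Function.Surjective f) {M : Subgroup (As X)} [M.Normal]
    (hM : ∀ x y, f x = f y → (As.e x)⁻¹ * As.e y ∈ M) : (As.map f).ker ≤ M := by
  let π := QuotientGroup.mk' M
  have π_e_congr {x y : X} (h : f x = f y) : π (As.e x) = π (As.e y) :=
    QuotientGroup.eq.2 (hM x y h)
  obtain ⟨s, hs⟩ := hf.hasRightInverse
  have s_lhd (x y : Y) : f (s (lhd x y)) = f (lhd (s x) (s y)) := by
    rw [hs, lhd, lhd, ShelfHom.map_act, hs, hs]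
  -- The section `s` of `f` is merely a map, but it respects the operation modulo `M`.
  let σ : As Y →* As X ⧸ M := As.lift (fun y => π (As.e (s y))) fun x y => by
    rw [π_e_congr (s_lhd x y), As.e_lhd, map_mul, map_mul, map_inv]
  have σ_comp_map : σ.comp (As.map f) = π := As.hom_ext fun x => by
    rw [MonoidHom.comp_apply, As.map_e, As.lift_e]
    exact π_e_congr (hs (f x))
  intro g hg
  rw [← QuotientGroup.ker_mk' M, MonoidHom.mem_ker, ← show σ (As.map f g) = _ from
    DFunLike.congr_fun σ_comp_map g, MonoidHom.mem_ker.1 hg, map_one]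

theorem As.mem_center_of_ract_eq {g : As X} (hg : ∀ x, ract x g = x) :
    g ∈ Subgroup.center (As X) := by
  rw [← Subgroup.centralizer_univ, ← Subgroup.coe_top, ← As.closure_range_e,
    Subgroup.centralizer_closure, Subgroup.mem_centralizer_iff]
  rintro _ ⟨x, rfl⟩
  have he := As.e_ract g x
  rwa [hg, mul_assoc, eq_inv_mul_iff_mul_eq, eq_comm] at he

theorem ract_e_pow (x y : X) (n : ℕ) : ract x (As.e y ^ n) = (fun z => lhd z y)^[n] x := by
  induction n with
  | zero => exact ract_one x
  | succ n ih => rw [pow_succ, ract_mul, ih, ract_e, Function.iterate_succ_apply']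

theorem ract_e_zpow_self (x : X) (n : ℤ) : ract x (As.e x ^ n) = x := by
  have h : (As.perm X (As.e x)).unop x = x := (ract_e x x).trans Quandle.fix
  rw [ract, map_zpow, MulOpposite.unop_zpow]
  exact Equiv.Perm.zpow_apply_eq_self_of_apply_eq_self h n

end AdjointGroup

/-- `X` is an `N`-quandle in the sense of Joyce: `N` operations by the same element are trivial.
A quandle of type `t` is a `t`-quandle. -/
def IsNQuandle (X : Type u) [Quandle X] (N : ℕ) : Prop :=
  ∀ x y : X, (fun z => lhd z y)^[N] x = x

namespace IsNQuandle

variable {X : Type u} [Quandle X] {N : ℕ}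

theorem e_pow_mem_center (hN : IsNQuandle X N) (x : X) : As.e x ^ N ∈ Subgroup.center (As X) :=
  As.mem_center_of_ract_eq fun y => by rw [ract_e_pow, hN]

theorem e_pow_eq (hN : IsNQuandle X N) (hX : IsConnected X) (x y : X) :
    As.e x ^ N = As.e y ^ N := by
  obtain ⟨g, rfl⟩ := hX.2 x y
  have conj_e_pow : (g⁻¹ * As.e x * g) ^ N = g⁻¹ * As.e x ^ N * g := by
    simpa only [inv_inv] using conj_pow (a := g⁻¹) (b := As.e x) (i := N)
  rw [As.e_ract, conj_e_pow, mul_assoc, ← Subgroup.mem_center_iff.1 (hN.e_pow_mem_center x),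
    inv_mul_cancel_left]

end IsNQuandle

namespace UnivCover

variable {X : Type u} [Quandle X] {a : X}

theorem proj_surjective (hX : IsConnected X) : Function.Surjective (proj X a) := by
  intro x
  obtain ⟨g, rfl⟩ := hX.2 a x
  refine ⟨⟨As.e a ^ (-(As.eps X g).toAdd) * g, ?_⟩, ?_⟩
  · rw [MonoidHom.mem_ker, map_mul, map_zpow, As.eps_e]
    apply Multiplicative.toAdd.injective
    simp
  · exact (ract_mul a _ g).trans (congrArg (ract · g) (ract_e_zpow_self a _))

theorem val_lhd (g h : UnivCover X a) :
    (lhd g h).val = (As.e a)⁻¹ * g.val * As.e (proj X a h) := by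
  change (op g h).val = (As.e a)⁻¹ * g.val * As.e (ract a h.val)
  rw [val_op, As.e_ract]
  group

theorem val_ract (x : UnivCover X a) (g : As (UnivCover X a)) :
    (ract x g).val =
      As.e a ^ (-(As.eps (UnivCover X a) g).toAdd) * x.val * As.map (proj X a) g := by
  have mem_closure : g ∈ Subgroup.closure (Set.range As.e) :=
    As.closure_range_e (UnivCover X a) ▸ Subgroup.mem_top g
  induction mem_closure using Subgroup.closure_induction generalizing x with
  | mem _ hy =>
    obtain ⟨y, rfl⟩ := hy
    rw [ract_e, val_lhd, As.eps_e, As.map_e, toAdd_ofAdd, zpow_neg_one]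
  | one => simp
  | mul g h _ _ ihg ihh =>
    rw [ract_mul, ihh, ihg, MonoidHom.map_mul, MonoidHom.map_mul, toAdd_mul, neg_add_rev, zpow_add]
    group
  | inv g _ ih =>
    have hg := ih (ract x g⁻¹)
    rw [← ract_mul, inv_mul_cancel, ract_one] at hg
    rw [MonoidHom.map_inv, MonoidHom.map_inv, toAdd_inv, hg]
    group

theorem val_ract_of_eps_map_eq_one (x : UnivCover X a) {g : As (UnivCover X a)}
    (hg : As.eps X (As.map (proj X a) g) = 1) :
    (ract x g).val = x.val * As.map (proj X a) g := by
  rw [As.eps_map] at hg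
  simp [val_ract, hg]

theorem ker_map_proj_le_center :
    (As.map (proj X a)).ker ≤ Subgroup.center (As (UnivCover X a)) := by
  intro g hg
  rw [MonoidHom.mem_ker] at hg
  refine As.mem_center_of_ract_eq fun x => ext ?_
  rw [val_ract_of_eps_map_eq_one x (by rw [hg, map_one]), hg, mul_one]

theorem isConnected (hX : IsConnected X) : IsConnected (UnivCover X a) := by
  refine ⟨⟨⟨1, one_mem _⟩⟩, fun x y => ?_⟩
  obtain ⟨g, hg⟩ := As.map_surjective (proj_surjective (a := a) hX) (x.val⁻¹ * y.val)
  refine ⟨g, ext ?_⟩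
  rw [val_ract_of_eps_map_eq_one x (by simp [hg, eps_val]), hg, mul_inv_cancel_left]

theorem isNQuandle (hX : IsConnected X) {N : ℕ} (hN : IsNQuandle X N) :
    IsNQuandle (UnivCover X a) N := by
  intro x y
  refine ext ?_
  rw [← ract_e_pow, val_ract, MonoidHom.map_pow, MonoidHom.map_pow, As.eps_e, As.map_e,
    hN.e_pow_eq hX _ a, mul_assoc, Subgroup.mem_center_iff.1 (hN.e_pow_mem_center a)]
  simp [← mul_assoc]

open scoped IsMulCommutative in
theorem pow_eq_one_of_mem_ker (hX : IsConnected X) {N : ℕ} (hN : IsNQuandle X N)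
    {c : As (UnivCover X a)} (hc : c ∈ (As.map (proj X a)).ker) : c ^ N = 1 := by
  let M := (powMonoidHom (α := Subgroup.center (As (UnivCover X a))) N).ker.map
    (Subgroup.subtype _)
  have mem_M {x : As (UnivCover X a)} (hx : x ∈ (As.map (proj X a)).ker) (hxN : x ^ N = 1) :
      x ∈ M := ⟨⟨x, ker_map_proj_le_center hx⟩, Subtype.ext hxN, rfl⟩
  have : M.Normal := ⟨fun x hx g => by
    rwa [Subgroup.mem_center_iff.1 (Subgroup.map_subtype_le _ hx), mul_inv_cancel_right]⟩
  have e_diff_mem_M (g h : UnivCover X a) (hgh : proj X a g = proj X a h) :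
      (As.e g)⁻¹ * As.e h ∈ M := by
    have mem_ker : (As.e g)⁻¹ * As.e h ∈ (As.map (proj X a)).ker := by
      rw [MonoidHom.mem_ker, map_mul, map_inv, As.map_e, As.map_e, hgh, inv_mul_cancel]
    refine mem_M mem_ker ?_
    have commute : Commute (As.e g) ((As.e g)⁻¹ * As.e h) :=
      Subgroup.mem_center_iff.1 (ker_map_proj_le_center mem_ker) _
    have mul_pow := commute.mul_pow N
    rwa [mul_inv_cancel_left, (isNQuandle hX hN).e_pow_eq (isConnected hX) h g,
      left_eq_mul] at mul_pow
  obtain ⟨⟨c, _⟩, hcN, rfl⟩ := As.ker_map_le (proj_surjective hX) e_diff_mem_M hc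
  exact congrArg Subtype.val hcN

end UnivCover

theorem proposition5p5_general {X : Type*} [Quandle X] (hX : IsConnected X) {N : ℕ}
    (hN : IsNQuandle X N) (a : X) (n : ℕ) :
    IsAwayIso N (H.map n (As.map (UnivCover.proj X a))) := by
  refine isAwayIso_H_map (As.map_surjective (UnivCover.proj_surjective hX)) ?_ n
  intro ℓ hℓ hℓN
  exact isLocallyFinitePrimeTo_of_le_center UnivCover.ker_map_proj_le_center
    (fun _ => UnivCover.pow_eq_one_of_mem_ker hX hN) hℓ hℓN

end QuandleCovering

end

theorem proposition5p5 {X : Type*} [Quandle X] (hX : QuandleCovering.IsConnected X)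
    (t : ℕ) (ht : QuandleCovering.IsOfType X t) (a : X) :
    QuandleCovering.IsAwayIso t
      (QuandleCovering.H.map 3 (QuandleCovering.As.map (QuandleCovering.UnivCover.proj X a))) :=
  QuandleCovering.proposition5p5_general hX ht.1.2 a 3
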